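/- **Theorem.** Let $n=2$ or $n=3$. Let $\mathcal M$ be a finite mesh of convex $n$-dimensional polytopes in $\mathbb R^n$: a finite set of full-dimensional (closed, bounded) convex polytopes $\mathfrak m$, called elements, any two of which meet in a common, possibly empty, face. Let $\mathbf v_1,\dots,\mathbf v_p$ be an enumeration without repetition of all vertices of all elements. For each $\mathfrak m\in\mathcal M$ let $\{\lambda^{\mathfrak m}_i : \mathbf v_i\in\mathfrak m\}$ be generalized barycentric coordinates on $\mathfrak m$, i.e. non-negative functions $\mathfrak m\to\mathbb R$ with $$L=\sum_{i:\,\mathbf v_i\in\mathfrak m}L(\mathbf v_i)\,\lambda^{\mathfrak m}_i \quad\text{on } \mathfrak m$$ for every affine function $L:\mathbb R^n\to\mathbb R$; assume that each $\lambda_i^{\mathfrak m}$ is Lipschitz on $\mathfrak m$ (so that $\nabla\lambda_i^{\mathfrak m}$ exists almost everywhere and is bounded). Define the hat functions $\hat\lambda_1,\dots,\hat\lambda_p$ on $\bigcup_{\mathfrak m\in\mathcal M}\mathfrak m$ by $$\hat\lambda_i(\mathbf x)=\begin{cases}\lambda_i^{\mathfrak m}(\mathbf x)&\text{if }\mathbf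 x\in\mathfrak m\text{ and }\mathbf v_i\in\mathfrak m,\\ 0&\text{if }\mathbf x\in\mathfrak m\text{ but }\mathbf v_i\notin\mathfrak m;\end{cases}$$ if $n=3$, assume that these prescriptions agree on the intersection of any two elements, so that $\hat\lambda_i$ is well defined (if $n=2$ this is automatic). Let $$\mathbf u\in\operatorname{span}_{\mathbb R}\bigl\{\hat\lambda_i\nabla\hat\lambda_j : \text{there is } \mathfrak m\in\mathcal M\text{ with }\mathbf v_i,\mathbf v_j\in\mathfrak m\bigr\},$$ where the gradients are taken elementwise (almost everywhere), and $\mathbf v_i,\mathbf v_j$ need not be joined by an edge. Then $\mathbf u\in H(\mathrm{curl},\Omega)$, where $\Omega$ is the interior of $\bigcup_{\mathfrak m\in\mathcal M}\mathfrak m$. That is, $\mathbf u\in L^2(\Omega)^n$ and the distributional curl of $\mathbf u$ on $\Omega$ (the scalar $\partial_y u_1-\partial_x u_2$ if $n=2$, the usual vector curl if $n=3$) is given by a square-integrable function on $\Omega$. -/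

import Mathlib

noncomputable section

/-- Euclidean `n`-space. -/
abbrev Euc (n : ℕ) := EuclideanSpace ℝ (Fin n)

/-! ### Meshes of convex polytopes -/

/-- A finite mesh of convex `n`-dimensional polytopes in `ℝⁿ`, i.e. a (face-to-face) cellular
complex, given by its `n`-dimensional cells; the lower-dimensional cells are the faces of these.
A face of a polytope is the empty set or a set of maximizers of a linear functional. -/
structure PolytopalMesh (n : ℕ) where
  /-- the `n`-dimensional (closed) elements -/
  cells : Finset (Set (Euc n))
  isPolytope : ∀ m ∈ cells, ∃ s : Finset (Euc n), m = convexHull ℝ (s : Set (Euc n))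
  fullDim : ∀ m ∈ cells, (interior m).Nonempty
  /-- any two elements meet in a common (possibly empty) face
  (for the second element, exchange the roles of the two) -/
  inter_face : ∀ m ∈ cells, ∀ m' ∈ cells, IsExposed ℝ m (m ∩ m')

namespace PolytopalMesh

variable {n : ℕ}

/-- The open set which the mesh subdivides: the interior of the union of its elements. -/
def domain (M : PolytopalMesh n) : Set (Euc n) :=
  interior (⋃ m ∈ M.cells, m)

/-- The vertices of the mesh: all vertices (extreme points) of its elements. -/
def vertices (M : PolytopalMesh n) : Set (Euc n) :=
  ⋃ m ∈ M.cells, Set.extremePoints ℝ m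

/-- `v₁, …, v_p` is an ordering (without repetitions) of all the vertices of the mesh. -/
def IsVertexOrdering (M : PolytopalMesh n) {p : ℕ} (v : Fin p → Euc n) : Prop :=
  Function.Injective v ∧ Set.range v = M.vertices

end PolytopalMesh

/-! ### Generalized barycentric coordinates and hat functions -/

open Classical in
/-- `(l i)`, over the indices `i` with `v i ∈ m`, are generalized barycentric coordinates on the
polytope `m` whose vertices are the `v i` lying in `m`: they are non-negative on `m` and reproduce
every (affine) linear function `L` from its values at the vertices. The values of `l i` for
`v i ∉ m` play no role. -/
structure IsGenBarycentric {n p : ℕ} (m : Set (Euc n)) (v : Fin p → Euc n)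
    (l : Fin p → Euc n → ℝ) : Prop where
  nonneg : ∀ i, v i ∈ m → ∀ x ∈ m, 0 ≤ l i x
  linear_precision : ∀ L : Euc n →ᵃ[ℝ] ℝ, ∀ x ∈ m,
    L x = ∑ i ∈ Finset.univ.filter (fun i => v i ∈ m), L (v i) * l i x

open Classical in
/-- The contribution of the element `m` to the `i`-th hat function: the coordinate `l i` of `m` if
`v i` is a vertex of `m`, and zero otherwise. -/
def localHat {n p : ℕ} (m : Set (Euc n)) (v : Fin p → Euc n) (l : Fin p → Euc n → ℝ)
    (i : Fin p) (x : Euc n) : ℝ :=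
  if v i ∈ m then l i x else 0

open Classical in
/-- The `i`-th generalized barycentric hat function, defined piecewise over the mesh from the
coordinates `lam m` on the elements `m`: its value at `x ∈ m` is `lam m i x` if `v i ∈ m` and `0`
if `v i ∉ m`. Off the mesh it is `0`. At a point `x` shared by several elements one of them is
chosen; such points form a null set, and if the coordinates agree on shared faces then the choice
does not matter. -/
def hatFunction {n p : ℕ} (M : PolytopalMesh n) (v : Fin p → Euc n)
    (lam : Set (Euc n) → Fin p → Euc n → ℝ) (i : Fin p) (x : Euc n) : ℝ :=
  if h : ∃ m ∈ M.cells, x ∈ m then localHat h.choose v (lam h.choose) i x else 0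

/-- The pieces of every hat function agree on the intersection of any two elements, so that the hat
functions are well defined. -/
def AgreeOnSharedFaces {n p : ℕ} (M : PolytopalMesh n) (v : Fin p → Euc n)
    (lam : Set (Euc n) → Fin p → Euc n → ℝ) : Prop :=
  ∀ m ∈ M.cells, ∀ m' ∈ M.cells, ∀ x ∈ m ∩ m', ∀ i,
    localHat m v (lam m) i x = localHat m' v (lam m') i x

/-- On every element, every coordinate function is Lipschitz. In particular it has a gradient
almost everywhere, and this gradient is bounded. -/
def LipschitzOnElements {n p : ℕ} (M : PolytopalMesh n) (v : Fin p → Euc n)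
    (lam : Set (Euc n) → Fin p → Euc n → ℝ) : Prop :=
  ∀ m ∈ M.cells, ∀ i, v i ∈ m → ∃ K : NNReal, LipschitzOnWith K (lam m i) m

/-- The vector fields `λ̂ᵢ ∇λ̂ⱼ` such that some element of the mesh contains both `vᵢ` and `vⱼ`. -/
def hatGradHatFields {n p : ℕ} (M : PolytopalMesh n) (v : Fin p → Euc n)
    (lam : Set (Euc n) → Fin p → Euc n → ℝ) : Set (Euc n → Euc n) :=
  {w | ∃ i j, (∃ m ∈ M.cells, v i ∈ m ∧ v j ∈ m) ∧
    w = fun x => hatFunction M v lam i x • gradient (hatFunction M v lam j) x}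

/-! ### The spaces `H(curl, Ω)` in dimensions two and three -/

/-- The partial derivative `∂φ/∂xᵢ`. -/
def partialD {n : ℕ} (i : Fin n) (φ : Euc n → ℝ) (x : Euc n) : ℝ :=
  fderiv ℝ φ x (EuclideanSpace.single i 1)

/-- Test fields: smooth, with compact support contained in `Ω`. -/
structure IsTestField {n : ℕ} {F : Type} [NormedAddCommGroup F] [NormedSpace ℝ F]
    (Ω : Set (Euc n)) (φ : Euc n → F) : Prop where
  smooth : ContDiff ℝ (⊤ : ℕ∞) φ
  compact : HasCompactSupport φ
  support_subset : tsupport φ ⊆ Ω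

/-- The classical curl of a vector field on `ℝ³`. -/
def curl3 (φ : Euc 3 → Euc 3) (x : Euc 3) : Euc 3 :=
  !₂[partialD 1 (fun y => φ y 2) x - partialD 2 (fun y => φ y 1) x,
     partialD 2 (fun y => φ y 0) x - partialD 0 (fun y => φ y 2) x,
     partialD 0 (fun y => φ y 1) x - partialD 1 (fun y => φ y 0) x]

/-- `c` is the weak curl on `Ω ⊆ ℝ²` of `u`, where `curl u = ∂u₁/∂y - ∂u₂/∂x` is a scalar. -/
def IsWeakCurl2 (Ω : Set (Euc 2)) (u : Euc 2 → Euc 2) (c : Euc 2 → ℝ) : Prop :=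
  ∀ φ : Euc 2 → ℝ, IsTestField Ω φ →
    ∫ x in Ω, c x * φ x = - ∫ x in Ω, (u x 0 * partialD 1 φ x - u x 1 * partialD 0 φ x)

/-- `c` is the weak curl on `Ω ⊆ ℝ³` of `u`. -/
def IsWeakCurl3 (Ω : Set (Euc 3)) (u c : Euc 3 → Euc 3) : Prop :=
  ∀ φ : Euc 3 → Euc 3, IsTestField Ω φ →
    ∫ x in Ω, inner ℝ (c x) (φ x) = ∫ x in Ω, inner ℝ (u x) (curl3 φ x)

/-- `u ∈ H(curl, Ω)` for `Ω ⊆ ℝ²`: `u` and its weak curl are square integrable on `Ω`. -/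
def MemHCurl2 (Ω : Set (Euc 2)) (u : Euc 2 → Euc 2) : Prop :=
  MeasureTheory.MemLp u 2 (MeasureTheory.volume.restrict Ω) ∧
    ∃ c : Euc 2 → ℝ, MeasureTheory.MemLp c 2 (MeasureTheory.volume.restrict Ω) ∧
      IsWeakCurl2 Ω u c

/-- `u ∈ H(curl, Ω)` for `Ω ⊆ ℝ³`: `u` and its weak curl are square integrable on `Ω`. -/
def MemHCurl3 (Ω : Set (Euc 3)) (u : Euc 3 → Euc 3) : Prop :=
  MeasureTheory.MemLp u 2 (MeasureTheory.volume.restrict Ω) ∧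
    ∃ c : Euc 3 → Euc 3, MeasureTheory.MemLp c 2 (MeasureTheory.volume.restrict Ω) ∧
      IsWeakCurl3 Ω u c

end

/-!
Write `f = λ̂ᵢ` and `g = λ̂ⱼ`. The hat functions are continuous and piecewise Lipschitz on finitely
many closed elements, so they are Lipschitz on every ball in the domain
(`Convex.lipschitzOnWith_of_finite_closed_cover`): there is no jump across the interfaces. Hence
`f ∇g` is bounded, and formally

  `∂ⱼ(f ∂ᵢg) - ∂ᵢ(f ∂ⱼg) = ∂ⱼf ∂ᵢg - ∂ᵢf ∂ⱼg`,

which is bounded too, so that both are square integrable on the bounded domain. The identity holds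
weakly because weak second derivatives of the Lipschitz function `g` commute. As the test function
`f φ` that arises here is only Lipschitz, this is shown with difference quotients
(`LipschitzWith.integral_lineDeriv_mul_lineDeriv_comm`), using Rademacher's theorem and integration
by parts for Lipschitz functions. Both curls, in dimensions two and three, consist of entries of
the antisymmetric matrix on the left (`MemHCurl`).

In the plane, continuity of the hat functions is not a hypothesis but a consequence of linear
precision (`agreeOnSharedFaces_two`): on a face only the coordinates of its vertices survive, and
the common face of two different elements has at most two vertices, for which linear precision
determines the coordinates.
-/

noncomputable section

open MeasureTheory Filter Topology Set Metric
open scoped NNReal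

/-! ### Line derivatives of Lipschitz functions -/

section LineDeriv

variable {E : Type*} [NormedAddCommGroup E] [NormedSpace ℝ E] [MeasurableSpace E] [BorelSpace E]
  {μ : Measure E} {C D : ℝ≥0} {f g : E → ℝ}

theorem lineDeriv_eq_zero_of_notMem_tsupport {E : Type*} [NormedAddCommGroup E] [NormedSpace ℝ E]
    {f : E → ℝ} {x : E} (hx : x ∉ tsupport f) (v : E) : lineDeriv ℝ f x v = 0 := by
  rw [(notMem_tsupport_iff_eventuallyEq.1 hx).lineDeriv_eq]
  simp [lineDeriv]

theorem LipschitzWith.integrable_lineDeriv_mul (hf : LipschitzWith C f) (hg : Integrable g μ)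
    (v : E) : Integrable (fun x ↦ lineDeriv ℝ f x v * g x) μ :=
  hg.bdd_mul (aestronglyMeasurable_lineDeriv hf.continuous μ)
    (.of_forall fun _ ↦ norm_lineDeriv_le_of_lipschitz ℝ hf)

theorem LipschitzWith.integrable_mul_lineDeriv [IsFiniteMeasureOnCompacts μ] {h : E → ℝ}
    (hg : LipschitzWith D g) (hh : Continuous h) (h'g : HasCompactSupport g) (v : E) :
    Integrable (fun x ↦ h x * lineDeriv ℝ g x v) μ := by
  have h1 : Integrable ((tsupport g).indicator h) μ :=
    (integrable_indicator_iff (isClosed_tsupport g).measurableSet).2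
      (hh.continuousOn.integrableOn_compact h'g)
  refine (hg.integrable_lineDeriv_mul h1 v).congr (.of_forall fun x ↦ ?_)
  by_cases hx : x ∈ tsupport g
  · simp [hx, mul_comm]
  · simp [hx, lineDeriv_eq_zero_of_notMem_tsupport hx]

variable [FiniteDimensional ℝ E] [μ.IsAddHaarMeasure]

/-- Weak second derivatives commute: if `f` and `g` are Lipschitz and `g` has compact support, then
`∫ ∂ᵥf ∂_w g = ∫ ∂_w f ∂ᵥg`. Replacing `∂_w g` by a difference quotient, one integration by parts
and a translation move the derivative `∂ᵥ` to `g` and the difference quotient to `f`. -/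
theorem LipschitzWith.integral_lineDeriv_mul_lineDeriv_comm (hf : LipschitzWith C f)
    (hg : LipschitzWith D g) (h'g : HasCompactSupport g) (v w : E) :
    ∫ x, lineDeriv ℝ f x v * lineDeriv ℝ g x w ∂μ =
      ∫ x, lineDeriv ℝ f x w * lineDeriv ℝ g x v ∂μ := by
  -- All difference quotients of `g` with step at most one are supported in `K`, so `∂ᵥf` may be
  -- cut off outside `K`, which makes it integrable.
  let K := cthickening ‖w‖ (tsupport g)
  have hK : IsCompact K := IsCompact.cthickening h'g
  have hfK : Integrable (K.indicator fun x ↦ lineDeriv ℝ f x v) μ :=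
    (integrable_indicator_iff hK.measurableSet).2
      ((hf.locallyIntegrable_lineDeriv v).integrableOn_isCompact hK)
  have hg0 : ∀ x ∉ K, ∀ t ∈ Icc (0 : ℝ) 1, g (x + t • w) = 0 := by
    intro x hx t ht
    rw [← Function.notMem_support]
    contrapose hx
    refine mem_cthickening_of_dist_le _ _ _ (tsupport g) (subset_tsupport _ hx) ?_
    simpa [dist_eq_norm, norm_smul, abs_of_nonneg ht.1] using
      mul_le_of_le_one_left (norm_nonneg w) ht.2
  have hg1 : ∀ x ∉ K, lineDeriv ℝ g x w = 0 := fun x hx ↦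
    lineDeriv_eq_zero_of_notMem_tsupport (fun h ↦ hx (self_subset_cthickening _ h)) w
  have A := integral_inv_smul_sub_mul_tendsto_integral_lineDeriv_mul hg hfK w
  have B := integral_inv_smul_sub_mul_tendsto_integral_lineDeriv_mul hf
    (by simpa using hg.integrable_mul_lineDeriv (μ := μ) (continuous_const (y := 1)) h'g (-v)) (-w)
  have hA : ∫ x, lineDeriv ℝ g x w * K.indicator (fun x ↦ lineDeriv ℝ f x v) x ∂μ =
      ∫ x, lineDeriv ℝ f x v * lineDeriv ℝ g x w ∂μ := by
    congr 1 with x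
    by_cases hx : x ∈ K
    · simp [hx, mul_comm]
    · simp [hx, hg1 x hx]
  have hB : ∫ x, lineDeriv ℝ f x (-w) * lineDeriv ℝ g x (-v) ∂μ =
      ∫ x, lineDeriv ℝ f x w * lineDeriv ℝ g x v ∂μ := by
    simp [lineDeriv_neg]
  have parts : ∀ a : E, ∫ x, lineDeriv ℝ f x v * g (x + a) ∂μ =
      ∫ x, f (x - a) * lineDeriv ℝ g x (-v) ∂μ := by
    intro a
    have hga : LipschitzWith D fun x ↦ g (x + a) := fun x y ↦ by
      simpa using hg (x + a) (y + a)
    have hgca : HasCompactSupport fun x ↦ g (x + a) :=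
      h'g.comp_homeomorph (Homeomorph.addRight a)
    rw [integral_lineDeriv_mul_eq hf hga hgca v,
      ← integral_add_right_eq_self (fun x ↦ f (x - a) * lineDeriv ℝ g x (-v)) a]
    congr 1 with x
    have : lineDeriv ℝ (fun x ↦ g (x + a)) x (-v) = lineDeriv ℝ g (x + a) (-v) := by
      simp only [lineDeriv, add_right_comm]
    rw [this, add_sub_cancel_right, mul_comm]
  have int1 : ∀ a : E, Integrable (fun x ↦ lineDeriv ℝ f x v * g (x + a)) μ := fun a ↦
    hf.integrable_lineDeriv_mul
      ((hg.continuous.comp (continuous_add_const a)).integrable_of_hasCompactSupport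
        (h'g.comp_homeomorph (Homeomorph.addRight a))) v
  have int2 : ∀ a : E, Integrable (fun x ↦ f (x - a) * lineDeriv ℝ g x (-v)) μ := fun a ↦
    hg.integrable_mul_lineDeriv (h := fun x ↦ f (x - a))
      (hf.continuous.comp (by fun_prop)) h'g (-v)
  rw [← hA, ← hB]
  refine tendsto_nhds_unique A (B.congr' ?_)
  filter_upwards [Ioc_mem_nhdsGT zero_lt_one] with t ht
  calc ∫ x, t⁻¹ • (f (x + t • -w) - f x) * lineDeriv ℝ g x (-v) ∂μ
      = t⁻¹ * (∫ x, f (x - t • w) * lineDeriv ℝ g x (-v) ∂μ -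
          ∫ x, f (x - 0) * lineDeriv ℝ g x (-v) ∂μ) := by
        rw [← integral_sub (int2 _) (int2 _), ← integral_const_mul]
        congr 1 with x
        simp only [smul_neg, ← sub_eq_add_neg, sub_zero, smul_eq_mul]
        ring
    _ = ∫ x, t⁻¹ • (g (x + t • w) - g x) * K.indicator (fun x ↦ lineDeriv ℝ f x v) x ∂μ := by
        rw [← parts, ← parts, ← integral_sub (int1 _) (int1 _), ← integral_const_mul]
        congr 1 with x
        by_cases hx : x ∈ K
        · simp only [hx, indicator_of_mem, add_zero, smul_eq_mul]
          ring
        · have h0 : g x = 0 := by simpa using hg0 x hx 0 (by simp)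
          simp [hx, hg0 x hx t ⟨ht.1.le, ht.2⟩, h0]

end LineDeriv

/-! ### Partial derivatives and test functions -/

theorem partialD_congr {n : ℕ} {f g : Euc n → ℝ} {x : Euc n} (h : f =ᶠ[𝓝 x] g) (i : Fin n) :
    partialD i f x = partialD i g x := by
  rw [partialD, partialD, h.fderiv_eq]

theorem partialD_eq_zero_of_notMem_tsupport {n : ℕ} {f : Euc n → ℝ} {x : Euc n}
    (hx : x ∉ tsupport f) (i : Fin n) : partialD i f x = 0 := by
  rw [partialD_congr (notMem_tsupport_iff_eventuallyEq.1 hx)]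
  simp [partialD]

theorem DifferentiableAt.lineDeriv_single {n : ℕ} {f : Euc n → ℝ} {x : Euc n}
    (h : DifferentiableAt ℝ f x) (i : Fin n) :
    lineDeriv ℝ f x (EuclideanSpace.single i 1) = partialD i f x :=
  h.lineDeriv_eq_fderiv

theorem gradient_apply {n : ℕ} (f : Euc n → ℝ) (x : Euc n) (i : Fin n) :
    gradient f x i = partialD i f x := by
  have h : inner ℝ (gradient f x) (EuclideanSpace.single i (1 : ℝ)) = partialD i f x := by
    simp [gradient, partialD]
  rw [← h, EuclideanSpace.inner_single_right]
  simp

theorem abs_partialD_le {n : ℕ} (i : Fin n) (f : Euc n → ℝ) (x : Euc n) :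
    |partialD i f x| ≤ ‖fderiv ℝ f x‖ := by
  simpa [partialD] using (fderiv ℝ f x).le_opNorm (EuclideanSpace.single i 1)

theorem measurable_partialD {n : ℕ} (i : Fin n) (f : Euc n → ℝ) : Measurable (partialD i f) :=
  measurable_fderiv_apply_const ℝ f _

namespace IsTestField

variable {n : ℕ} {Ω : Set (Euc n)} {φ : Euc n → ℝ}

theorem continuous_partialD (hφ : IsTestField Ω φ) (i : Fin n) : Continuous (partialD i φ) :=
  (hφ.smooth.continuous_fderiv (by simp)).clm_apply continuous_const

theorem hasCompactSupport_partialD (hφ : IsTestField Ω φ) (i : Fin n) :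
    HasCompactSupport (partialD i φ) :=
  HasCompactSupport.intro hφ.compact fun _ hx ↦ partialD_eq_zero_of_notMem_tsupport hx i

theorem memLp (hφ : IsTestField Ω φ) : MemLp φ 2 (volume.restrict Ω) :=
  (hφ.smooth.continuous.memLp_of_hasCompactSupport hφ.compact).restrict Ω

theorem memLp_partialD (hφ : IsTestField Ω φ) (i : Fin n) :
    MemLp (partialD i φ) 2 (volume.restrict Ω) :=
  ((hφ.continuous_partialD i).memLp_of_hasCompactSupport
    (hφ.hasCompactSupport_partialD i)).restrict Ω

theorem component {Φ : Euc n → Euc n} (hΦ : IsTestField Ω Φ) (i : Fin n) :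
    IsTestField Ω fun x ↦ Φ x i := by
  have hsub : tsupport (fun x ↦ Φ x i) ⊆ tsupport Φ :=
    closure_mono fun x hx h ↦ hx (by simp [h])
  refine ⟨?_, hΦ.compact.of_isClosed_subset (isClosed_tsupport _) hsub,
    hsub.trans hΦ.support_subset⟩
  exact (EuclideanSpace.proj (𝕜 := ℝ) i).contDiff.comp hΦ.smooth

end IsTestField

/-! ### Curls of products `f ∇g` -/

/-- `f` is locally Lipschitz on `Ω`, with one and the same constant `K` everywhere. -/
def LocallyLipschitzBy {n : ℕ} (K : ℝ≥0) (Ω : Set (Euc n)) (f : Euc n → ℝ) : Prop :=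
  ∀ x ∈ Ω, ∃ s ∈ 𝓝 x, LipschitzOnWith K f s

namespace LocallyLipschitzBy

variable {n : ℕ} {K : ℝ≥0} {Ω : Set (Euc n)} {f : Euc n → ℝ}

theorem continuousOn (hf : LocallyLipschitzBy K Ω f) : ContinuousOn f Ω := fun x hx ↦ by
  obtain ⟨s, hs, h⟩ := hf x hx
  exact (h.continuousOn.continuousAt hs).continuousWithinAt

theorem norm_fderiv_le (hf : LocallyLipschitzBy K Ω f) {x : Euc n} (hx : x ∈ Ω) :
    ‖fderiv ℝ f x‖ ≤ K := by
  obtain ⟨s, hs, h⟩ := hf x hx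
  exact norm_fderiv_le_of_lipschitzOn ℝ hs h

theorem exists_lipschitzOnWith (hf : LocallyLipschitzBy K Ω f) {T : Set (Euc n)}
    (hT : IsCompact T) (hTΩ : T ⊆ Ω) : ∃ C, LipschitzOnWith C f T := by
  refine LocallyLipschitzOn.exists_lipschitzOnWith_of_compact hT fun x hx ↦ ?_
  obtain ⟨s, hs, h⟩ := hf x (hTΩ hx)
  exact ⟨K, s, mem_nhdsWithin_of_mem_nhds hs, h⟩

end LocallyLipschitzBy

/-- The product of a Lipschitz function and a compactly supported Lipschitz function is
Lipschitz, although the first factor may be unbounded. -/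
theorem LipschitzWith.exists_lipschitzWith_mul {E : Type*} [PseudoMetricSpace E] {C D : ℝ≥0}
    {f g : E → ℝ} (hf : LipschitzWith C f) (hg : LipschitzWith D g) (h'g : HasCompactSupport g) :
    ∃ B, LipschitzWith B fun x ↦ f x * g x := by
  obtain ⟨a, ha⟩ := (show IsCompact (tsupport g) from h'g).exists_bound_of_continuousOn
    hf.continuous.continuousOn
  obtain ⟨b, hb⟩ := h'g.exists_bound_of_continuous hg.continuous
  have key : ∀ x ∈ tsupport g, ∀ y, |f x * g x - f y * g y| ≤ (|a| * D + |b| * C) * dist x y := by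
    intro x hx y
    have h1 : |f x| ≤ |a| := (ha x hx).trans (le_abs_self a)
    have h2 : |g y| ≤ |b| := (hb y).trans (le_abs_self b)
    have h3 : |g x - g y| ≤ D * dist x y := hg.dist_le_mul x y
    have h4 : |f x - f y| ≤ C * dist x y := hf.dist_le_mul x y
    calc |f x * g x - f y * g y| = |f x * (g x - g y) + g y * (f x - f y)| := by ring_nf
      _ ≤ |f x| * |g x - g y| + |g y| * |f x - f y| := by
        rw [← abs_mul, ← abs_mul]; exact abs_add_le _ _
      _ ≤ |a| * (D * dist x y) + |b| * (C * dist x y) := by gcongr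
      _ = _ := by ring
  refine ⟨⟨|a| * D + |b| * C, by positivity⟩, LipschitzWith.of_dist_le_mul fun x y ↦ ?_⟩
  rw [Real.dist_eq]
  by_cases hx : x ∈ tsupport g
  · exact key x hx y
  by_cases hy : y ∈ tsupport g
  · rw [abs_sub_comm, dist_comm]
    exact key y hy x
  · rw [image_eq_zero_of_notMem_tsupport hx, image_eq_zero_of_notMem_tsupport hy]
    simp only [mul_zero, sub_self, abs_zero]
    exact mul_nonneg (NNReal.coe_nonneg _) dist_nonneg

/-- The weak form of `∂ⱼ(f ∂ᵢg) - ∂ᵢ(f ∂ⱼg) = ∂ⱼf ∂ᵢg - ∂ᵢf ∂ⱼg` for globally Lipschitz functions: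
by the product rule the claim is that weak second derivatives of `g` commute against the
Lipschitz test function `f φ`. -/
theorem LipschitzWith.integral_curl_mul_gradient {n : ℕ} {C D : ℝ≥0} {Ω : Set (Euc n)}
    {f g φ : Euc n → ℝ} (hf : LipschitzWith C f) (hg : LipschitzWith D g) (hφ : IsTestField Ω φ)
    (i j : Fin n) :
    ∫ x, (partialD j f x * partialD i g x - partialD i f x * partialD j g x) * φ x =
      -∫ x, (f x * partialD i g x * partialD j φ x - f x * partialD j g x * partialD i φ x) := by
  have hφd : Differentiable ℝ φ := hφ.smooth.differentiable (by simp)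
  obtain ⟨A, hA⟩ := ContDiff.lipschitzWith_of_hasCompactSupport hφ.compact hφ.smooth (by simp)
  obtain ⟨B, hB⟩ := hf.exists_lipschitzWith_mul hA hφ.compact
  have hBc : HasCompactSupport fun x ↦ f x * φ x := hφ.compact.mul_left
  have comm := hg.integral_lineDeriv_mul_lineDeriv_comm (μ := volume) hB hBc
    (EuclideanSpace.single i 1) (EuclideanSpace.single j 1)
  have aef := hf.ae_differentiableAt (μ := volume)
  have aeg := hg.ae_differentiableAt (μ := volume)
  have prod : ∀ k, ∀ x, DifferentiableAt ℝ f x →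
      lineDeriv ℝ (fun x ↦ f x * φ x) x (EuclideanSpace.single k 1) =
        f x * partialD k φ x + φ x * partialD k f x := by
    intro k x hx
    rw [(hx.fun_mul (hφd x)).lineDeriv_single, partialD, fderiv_fun_mul hx (hφd x)]
    simp [partialD]
  have int1 : ∀ k l, Integrable fun x ↦ f x * partialD k g x * partialD l φ x := by
    intro k l
    refine (hg.integrable_lineDeriv_mul (μ := volume) (g := fun x ↦ f x * partialD l φ x) ?_
      (EuclideanSpace.single k 1)).congr ?_
    · exact (hf.continuous.mul (hφ.continuous_partialD l)).integrable_of_hasCompactSupport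
        (hφ.hasCompactSupport_partialD l).mul_left
    · filter_upwards [aeg] with x hx
      rw [hx.lineDeriv_single]
      ring
  have int2 : ∀ k l, Integrable fun x ↦ partialD k f x * partialD l g x * φ x := by
    intro k l
    refine (hf.integrable_lineDeriv_mul (hg.integrable_lineDeriv_mul (μ := volume)
      (hφ.smooth.continuous.integrable_of_hasCompactSupport hφ.compact)
      (EuclideanSpace.single l 1)) (EuclideanSpace.single k 1)).congr ?_
    filter_upwards [aef, aeg] with x hx hx'
    rw [hx.lineDeriv_single, hx'.lineDeriv_single]
    ring
  have expand : ∀ k l, ∫ x, lineDeriv ℝ g x (EuclideanSpace.single k 1) *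
      lineDeriv ℝ (fun x ↦ f x * φ x) x (EuclideanSpace.single l 1) =
      (∫ x, f x * partialD k g x * partialD l φ x) +
        ∫ x, partialD l f x * partialD k g x * φ x := by
    intro k l
    rw [← integral_add (int1 k l) (int2 l k)]
    refine integral_congr_ae ?_
    filter_upwards [aef, aeg] with x hx hx'
    rw [prod l x hx, hx'.lineDeriv_single]
    ring
  rw [expand, expand] at comm
  simp only [sub_mul]
  rw [integral_sub (int2 j i) (int2 i j), integral_sub (int1 i j) (int1 j i)]
  linarith

/-- The localization of `LipschitzWith.integral_curl_mul_gradient` to an open set. -/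
theorem LocallyLipschitzBy.integral_curl_mul_gradient {n : ℕ} {K L : ℝ≥0} {Ω : Set (Euc n)}
    (hΩ : IsOpen Ω) {f g φ : Euc n → ℝ} (hf : LocallyLipschitzBy K Ω f)
    (hg : LocallyLipschitzBy L Ω g) (hφ : IsTestField Ω φ) (i j : Fin n) :
    ∫ x in Ω, (partialD j f x * partialD i g x - partialD i f x * partialD j g x) * φ x =
      -∫ x in Ω, (f x * partialD i g x * partialD j φ x -
        f x * partialD j g x * partialD i φ x) := by
  -- Near the support of `φ`, replace `f` and `g` by global Lipschitz functions.
  obtain ⟨T, hT, hφT, hTΩ⟩ := exists_compact_between hφ.compact hΩ hφ.support_subset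
  obtain ⟨C, hC⟩ := hf.exists_lipschitzOnWith hT hTΩ
  obtain ⟨D, hD⟩ := hg.exists_lipschitzOnWith hT hTΩ
  obtain ⟨F, hF, hfF⟩ := hC.extend_real
  obtain ⟨G, hG, hgG⟩ := hD.extend_real
  have key := hF.integral_curl_mul_gradient hG hφ i j
  have evf : ∀ x ∈ tsupport φ, f =ᶠ[𝓝 x] F := fun x hx ↦
    hfF.eventuallyEq_of_mem (mem_interior_iff_mem_nhds.1 (hφT hx))
  have evg : ∀ x ∈ tsupport φ, g =ᶠ[𝓝 x] G := fun x hx ↦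
    hgG.eventuallyEq_of_mem (mem_interior_iff_mem_nhds.1 (hφT hx))
  rw [setIntegral_eq_integral_of_forall_compl_eq_zero,
    setIntegral_eq_integral_of_forall_compl_eq_zero]
  · convert key using 2
    · ext x
      by_cases hx : x ∈ tsupport φ
      · simp only [partialD_congr (evf x hx), partialD_congr (evg x hx)]
      · simp [image_eq_zero_of_notMem_tsupport hx]
    · congr 1 with x
      by_cases hx : x ∈ tsupport φ
      · simp only [(evf x hx).eq_of_nhds, partialD_congr (evg x hx)]
      · simp [partialD_eq_zero_of_notMem_tsupport hx]
  · intro x hx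
    simp [partialD_eq_zero_of_notMem_tsupport fun h ↦ hx (hφ.support_subset h)]
  · intro x hx
    simp [image_eq_zero_of_notMem_tsupport fun h ↦ hx (hφ.support_subset h)]

/-! ### A dimension-free form of `H(curl, Ω)` -/

/-- `u` is square integrable on `Ω`, and so is its curl, understood in any dimension as the
antisymmetric matrix with entries `∂ⱼuᵢ - ∂ᵢuⱼ` (in the weak sense). -/
def MemHCurl {n : ℕ} (Ω : Set (Euc n)) (u : Euc n → Euc n) : Prop :=
  MemLp u 2 (volume.restrict Ω) ∧ ∀ i j, ∃ c : Euc n → ℝ, MemLp c 2 (volume.restrict Ω) ∧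
    ∀ φ : Euc n → ℝ, IsTestField Ω φ →
      ∫ x in Ω, c x * φ x = -∫ x in Ω, (u x i * partialD j φ x - u x j * partialD i φ x)

theorem MeasureTheory.MemLp.euc_apply {n : ℕ} {μ : Measure (Euc n)} {u : Euc n → Euc n}
    (hu : MemLp u 2 μ) (i : Fin n) : MemLp (fun x ↦ u x i) 2 μ :=
  (EuclideanSpace.proj (𝕜 := ℝ) i).comp_memLp' hu

namespace MemHCurl

variable {n : ℕ} {Ω : Set (Euc n)} {u w : Euc n → Euc n}

theorem zero : MemHCurl Ω (0 : Euc n → Euc n) :=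
  ⟨MemLp.zero', fun _ _ ↦ ⟨0, MemLp.zero', fun φ _ ↦ by simp⟩⟩

theorem add (hu : MemHCurl Ω u) (hw : MemHCurl Ω w) : MemHCurl Ω (u + w) := by
  refine ⟨hu.1.add hw.1, fun i j ↦ ?_⟩
  obtain ⟨c, hc, hcu⟩ := hu.2 i j
  obtain ⟨d, hd, hdw⟩ := hw.2 i j
  refine ⟨c + d, hc.add hd, fun φ hφ ↦ ?_⟩
  have I : ∀ {v : Euc n → Euc n}, MemLp v 2 (volume.restrict Ω) → Integrable (fun x ↦
      v x i * partialD j φ x - v x j * partialD i φ x) (volume.restrict Ω) := fun hv ↦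
    ((hv.euc_apply i).integrable_mul (hφ.memLp_partialD j)).sub
      ((hv.euc_apply j).integrable_mul (hφ.memLp_partialD i))
  calc ∫ x in Ω, (c + d) x * φ x = (∫ x in Ω, c x * φ x) + ∫ x in Ω, d x * φ x := by
        simp only [Pi.add_apply, add_mul]
        exact integral_add (hc.integrable_mul hφ.memLp) (hd.integrable_mul hφ.memLp)
    _ = _ := by
        rw [hcu φ hφ, hdw φ hφ, ← neg_add, ← integral_add (I hu.1) (I hw.1)]
        congr 2 with x
        simp only [Pi.add_apply, PiLp.add_apply]
        ring

theorem smul (a : ℝ) (hu : MemHCurl Ω u) : MemHCurl Ω (a • u) := by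
  refine ⟨hu.1.const_smul a, fun i j ↦ ?_⟩
  obtain ⟨c, hc, hcu⟩ := hu.2 i j
  refine ⟨a • c, hc.const_smul a, fun φ hφ ↦ ?_⟩
  simp only [Pi.smul_apply, smul_eq_mul, PiLp.smul_apply, mul_assoc, ← mul_sub,
    integral_const_mul]
  rw [hcu φ hφ, mul_neg]

theorem memHCurl2 {Ω : Set (Euc 2)} {u : Euc 2 → Euc 2} (hu : MemHCurl Ω u) : MemHCurl2 Ω u :=
  ⟨hu.1, hu.2 0 1⟩

theorem memHCurl3 {Ω : Set (Euc 3)} {u : Euc 3 → Euc 3} (hu : MemHCurl Ω u) : MemHCurl3 Ω u := by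
  obtain ⟨c₀, hc₀, h₀⟩ := hu.2 2 1
  obtain ⟨c₁, hc₁, h₁⟩ := hu.2 0 2
  obtain ⟨c₂, hc₂, h₂⟩ := hu.2 1 0
  refine ⟨hu.1, fun x ↦ !₂[c₀ x, c₁ x, c₂ x], ?_, fun φ hφ ↦ ?_⟩
  · refine MemLp.of_eval_piLp fun i ↦ ?_
    fin_cases i
    exacts [hc₀, hc₁, hc₂]
  have I : ∀ i j k, Integrable (fun x ↦ -(u x i * partialD j (fun y ↦ φ y k) x -
      u x j * partialD i (fun y ↦ φ y k) x)) (volume.restrict Ω) := fun i j k ↦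
    (((hu.1.euc_apply i).integrable_mul ((hφ.component k).memLp_partialD j)).sub
      ((hu.1.euc_apply j).integrable_mul ((hφ.component k).memLp_partialD i))).neg
  have J : ∀ {c : Euc 3 → ℝ} (k), MemLp c 2 (volume.restrict Ω) →
      Integrable (fun x ↦ c x * φ x k) (volume.restrict Ω) := fun k hc ↦
    hc.integrable_mul (hφ.component k).memLp
  calc ∫ x in Ω, inner ℝ (!₂[c₀ x, c₁ x, c₂ x] : Euc 3) (φ x)
      = ∫ x in Ω, (c₀ x * φ x 0 + c₁ x * φ x 1 + c₂ x * φ x 2) := by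
        congr 1 with x
        simp [PiLp.inner_apply, Fin.sum_univ_three, mul_comm]
    _ = (∫ x in Ω, c₀ x * φ x 0) + (∫ x in Ω, c₁ x * φ x 1) + ∫ x in Ω, c₂ x * φ x 2 := by
        rw [integral_add ((J 0 hc₀).fun_add (J 1 hc₁)) (J 2 hc₂), integral_add (J 0 hc₀) (J 1 hc₁)]
    _ = ∫ x in Ω, inner ℝ (u x) (curl3 φ x) := by
        rw [h₀ _ (hφ.component 0), h₁ _ (hφ.component 1), h₂ _ (hφ.component 2),
          ← integral_neg, ← integral_neg, ← integral_neg,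
          ← integral_add (I 2 1 0) (I 0 2 1),
          ← integral_add ((I 2 1 0).fun_add (I 0 2 1)) (I 1 0 2)]
        congr 1 with x
        simp [PiLp.inner_apply, Fin.sum_univ_three, curl3]
        ring

end MemHCurl

/-- The field `f ∇g` belongs to `H(curl, Ω)`: its curl is built from products of the bounded
partial derivatives of `f` and `g`. -/
theorem LocallyLipschitzBy.memHCurl_smul_gradient {n : ℕ} {K L : ℝ≥0} {Ω : Set (Euc n)}
    (hΩ : IsOpen Ω) (hΩ' : Bornology.IsBounded Ω) {f g : Euc n → ℝ} {b : ℝ}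
    (hf : LocallyLipschitzBy K Ω f) (hb : ∀ x ∈ Ω, |f x| ≤ b) (hg : LocallyLipschitzBy L Ω g) :
    MemHCurl Ω fun x ↦ f x • gradient g x := by
  have : IsFiniteMeasure (volume.restrict Ω) := ⟨by simpa using hΩ'.measure_lt_top⟩
  have hfm : AEStronglyMeasurable f (volume.restrict Ω) :=
    hf.continuousOn.aestronglyMeasurable hΩ.measurableSet
  have M : ∀ {h : Euc n → ℝ} {K : ℝ≥0}, LocallyLipschitzBy K Ω h → ∀ k,
      MemLp (partialD k h) ⊤ (volume.restrict Ω) := fun {h K} hh k ↦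
    memLp_top_of_bound (measurable_partialD k h).aestronglyMeasurable K <|
      ae_restrict_of_forall_mem hΩ.measurableSet fun x hx ↦
        (abs_partialD_le k h x).trans (hh.norm_fderiv_le hx)
  have hf' : MemLp f ⊤ (volume.restrict Ω) :=
    memLp_top_of_bound hfm b (ae_restrict_of_forall_mem hΩ.measurableSet hb)
  refine ⟨MemLp.of_eval_piLp fun i ↦ ?_, fun i j ↦
    ⟨fun x ↦ partialD j f x * partialD i g x - partialD i f x * partialD j g x, ?_,
      fun φ hφ ↦ ?_⟩⟩
  · simp only [PiLp.smul_apply, gradient_apply, smul_eq_mul]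
    exact (MemLp.mul (M hg i) hf' (r := ⊤)).mono_exponent le_top
  · exact ((MemLp.mul (M hg i) (M hf j) (r := ⊤)).sub
      (MemLp.mul (M hg j) (M hf i) (r := ⊤))).mono_exponent le_top
  · simp only [PiLp.smul_apply, gradient_apply, smul_eq_mul]
    exact hf.integral_curl_mul_gradient hΩ hg hφ i j

/-! ### Piecewise Lipschitz functions -/

/-- A function which is `K`-Lipschitz on each of finitely many closed sets is `K`-Lipschitz on every
convex set that they cover. Along a segment, every point is approached from the right within one
of the closed sets, so that the right lower derivative is at most `K` times the length of the
segment. -/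
theorem Convex.lipschitzOnWith_of_finite_closed_cover {E : Type*} [NormedAddCommGroup E]
    [NormedSpace ℝ E] {S : Finset (Set E)} {C : Set E} {f : E → ℝ} {K : ℝ≥0} (hC : Convex ℝ C)
    (hS : ∀ s ∈ S, IsClosed s) (hCS : C ⊆ ⋃ s ∈ S, s) (hf : ∀ s ∈ S, LipschitzOnWith K f s) :
    LipschitzOnWith K f C := by
  have hcont : ContinuousOn f (⋃ s : S, (s : Set E)) :=
    (locallyFinite_of_finite _).continuousOn_iUnion (fun s ↦ hS s s.2)
      fun s ↦ (hf s s.2).continuousOn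
  have hcover : ∀ x ∈ C, x ∈ ⋃ s : S, (s : Set E) := fun x hx ↦ by simpa using hCS hx
  refine LipschitzOnWith.of_le_add_mul K fun y hy x hx ↦ ?_
  let γ : ℝ → E := AffineMap.lineMap x y
  have hγ : Continuous γ := AffineMap.lineMap_continuous
  have hγC : ∀ t ∈ Icc (0 : ℝ) 1, γ t ∈ C := fun t ht ↦ hC.lineMap_mem hx hy ht
  have key := image_le_of_liminf_slope_right_le_deriv_boundary (f := f ∘ γ) (a := 0) (b := 1)
    (B := fun t ↦ f x + K * dist x y * t) (B' := fun _ ↦ K * dist x y)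
    (hcont.comp hγ.continuousOn fun t ht ↦ hcover _ (hγC t ht)) (by simp [γ])
    (by fun_prop)
    (fun t _ ↦ by
      simpa using (((hasDerivAt_id t).const_mul (K * dist x y)).const_add (f x)).hasDerivWithinAt)
    (fun t ht r hr ↦ ?_) (right_mem_Icc.2 zero_le_one)
  · simpa [γ, dist_comm] using key
  obtain ⟨s, hs, hfr⟩ : ∃ s ∈ S, ∃ᶠ z in 𝓝[>] t, γ z ∈ s := by
    by_contra! h
    have h' := (Filter.eventually_all_finset S).2 h
    obtain ⟨z, hz, hz'⟩ := (h'.and (Ioo_mem_nhdsGT ht.2)).exists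
    obtain ⟨s, hs, hzs⟩ := mem_iUnion₂.1 (hCS (hγC z ⟨ht.1.trans hz'.1.le, hz'.2.le⟩))
    exact hz s hs hzs
  -- As `s` is closed, it contains `γ t` too, so its Lipschitz bound applies to the slope at `t`.
  have hts : γ t ∈ s := (hS s hs).mem_of_frequently_of_tendsto hfr
    (hγ.continuousAt.tendsto.mono_left nhdsWithin_le_nhds)
  refine (hfr.and_eventually self_mem_nhdsWithin).mono fun z ⟨hzs, (hz : t < z)⟩ ↦
    lt_of_le_of_lt ?_ hr
  have h1 : |f (γ z) - f (γ t)| ≤ K * dist (γ z) (γ t) := (hf s hs).dist_le_mul _ hzs _ hts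
  have h2 : dist (γ z) (γ t) = (z - t) * dist x y := by
    rw [dist_lineMap_lineMap, Real.dist_eq, abs_of_pos (sub_pos.2 hz)]
  rw [slope_def_field, div_le_iff₀ (sub_pos.2 hz)]
  calc f (γ z) - f (γ t) ≤ K * dist (γ z) (γ t) := (le_abs_self _).trans h1
    _ = K * dist x y * (z - t) := by rw [h2]; ring

/-! ### Meshes and hat functions -/

namespace PolytopalMesh

variable {n : ℕ} (M : PolytopalMesh n)

theorem isCompact_cell {m : Set (Euc n)} (hm : m ∈ M.cells) : IsCompact m := by
  obtain ⟨s, rfl⟩ := M.isPolytope m hm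
  exact s.finite_toSet.isCompact_convexHull ℝ

theorem isBounded_domain : Bornology.IsBounded M.domain :=
  (M.cells.isCompact_biUnion fun _ hm ↦ M.isCompact_cell hm).isBounded.subset interior_subset

/-- As elements meet face to face, a mesh vertex can only be in an element as one of its
vertices. -/
theorem IsVertexOrdering.mem_extremePoints {M : PolytopalMesh n} {p : ℕ} {v : Fin p → Euc n}
    (hv : M.IsVertexOrdering v) {m : Set (Euc n)} (hm : m ∈ M.cells) {i : Fin p} (hi : v i ∈ m) :
    v i ∈ m.extremePoints ℝ := by
  have h : v i ∈ M.vertices := hv.2 ▸ mem_range_self i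
  obtain ⟨m', hm', hi'⟩ := mem_iUnion₂.1 h
  exact (IsExposed.isExtreme (M.inter_face m hm m' hm')).extremePoints_subset_extremePoints
    (inter_extremePoints_subset_extremePoints_of_subset inter_subset_right
      ⟨⟨hi, extremePoints_subset hi'⟩, hi'⟩)

end PolytopalMesh

section LocalHat

variable {n p : ℕ} {m : Set (Euc n)} {v : Fin p → Euc n} {l : Fin p → Euc n → ℝ}

theorem localHat_of_notMem {i : Fin p} (hi : v i ∉ m) (x : Euc n) : localHat m v l i x = 0 :=
  if_neg hi

namespace IsGenBarycentric

theorem localHat_nonneg (h : IsGenBarycentric m v l) (i : Fin p) {x : Euc n} (hx : x ∈ m) :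
    0 ≤ localHat m v l i x := by
  unfold localHat
  split_ifs with hi
  exacts [h.nonneg i hi x hx, le_rfl]

theorem sum_mul_localHat (h : IsGenBarycentric m v l) (L : Euc n →ᵃ[ℝ] ℝ) {x : Euc n}
    (hx : x ∈ m) : ∑ i, L (v i) * localHat m v l i x = L x := by
  rw [h.linear_precision L x hx, Finset.sum_filter]
  refine Finset.sum_congr rfl fun i _ ↦ ?_
  unfold localHat
  split_ifs <;> simp

theorem sum_localHat (h : IsGenBarycentric m v l) {x : Euc n} (hx : x ∈ m) :
    ∑ i, localHat m v l i x = 1 := by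
  simpa using h.sum_mul_localHat (AffineMap.const ℝ (Euc n) 1) hx

theorem abs_localHat_le_one (h : IsGenBarycentric m v l) (i : Fin p) {x : Euc n} (hx : x ∈ m) :
    |localHat m v l i x| ≤ 1 := by
  rw [abs_of_nonneg (h.localHat_nonneg i hx), ← h.sum_localHat hx]
  exact Finset.single_le_sum (fun j _ ↦ h.localHat_nonneg j hx) (Finset.mem_univ i)

/-- On a face, the coordinates of the vertices off that face vanish. -/
theorem localHat_eq_zero (h : IsGenBarycentric m v l) {F : Set (Euc n)} (hF : IsExposed ℝ m F)
    {x : Euc n} (hx : x ∈ F) {i : Fin p} (hi : v i ∉ F) : localHat m v l i x = 0 := by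
  by_cases him : v i ∈ m
  swap
  · exact localHat_of_notMem him x
  obtain ⟨a, rfl⟩ := hF ⟨x, hx⟩
  obtain ⟨y, hy, hiy⟩ : ∃ y ∈ m, a (v i) < a y := by simpa [him] using hi
  have hsum : ∑ j, (a x - a (v j)) * localHat m v l j x = 0 := by
    simp only [sub_mul, Finset.sum_sub_distrib, ← Finset.mul_sum]
    rw [h.sum_localHat hx.1]
    have := h.sum_mul_localHat a.toLinearMap.toAffineMap hx.1
    simp only [LinearMap.coe_toAffineMap, ContinuousLinearMap.coe_coe] at this
    linarith
  have hnonneg : ∀ j ∈ Finset.univ, 0 ≤ (a x - a (v j)) * localHat m v l j x := by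
    intro j _
    by_cases hj : v j ∈ m
    · exact mul_nonneg (sub_nonneg.2 (hx.2 _ hj)) (h.localHat_nonneg j hx.1)
    · simp [localHat_of_notMem hj]
  have := (Finset.sum_eq_zero_iff_of_nonneg hnonneg).1 hsum i (Finset.mem_univ i)
  exact (mul_eq_zero.1 this).resolve_left (sub_pos.2 (hiy.trans_le (hx.2 y hy))).ne'

end IsGenBarycentric

end LocalHat

theorem not_collinear_of_mem_extremePoints {E : Type*} [AddCommGroup E] [Module ℝ E] {F : Set E}
    {a b c : E} (ha : a ∈ F.extremePoints ℝ) (hb : b ∈ F.extremePoints ℝ)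
    (hc : c ∈ F.extremePoints ℝ) (hab : a ≠ b) (hac : a ≠ c) (hbc : b ≠ c) :
    ¬ Collinear ℝ {a, b, c} := by
  have key : ∀ {x y z : E}, x ∈ F.extremePoints ℝ → y ∈ F.extremePoints ℝ →
      z ∈ F.extremePoints ℝ → x ≠ y → y ≠ z → ¬ Wbtw ℝ x y z := by
    intro x y z hx hy hz hxy hyz h
    have hs : y ∈ openSegment ℝ x z := by
      rw [openSegment_eq_image_lineMap]
      exact Sbtw.mem_image_Ioo ⟨h, hxy.symm, hyz⟩
    exact hxy (hy.2 hx.1 hz.1 hs)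
  intro h
  rcases h.wbtw_or_wbtw_or_wbtw with h | h | h
  exacts [key ha hb hc hab hbc h, key hb hc ha hbc hac.symm h, key hc ha hb hac.symm hab h]

theorem collinear_of_forall_eq {E : Type*} [AddCommGroup E] [Module ℝ E]
    (hE : Module.finrank ℝ E = 2) {a : E →ₗ[ℝ] ℝ} (ha : a ≠ 0) {r : ℝ} {s : Set E}
    (hs : ∀ x ∈ s, a x = r) : Collinear ℝ s := by
  have : FiniteDimensional ℝ E := Module.finite_of_finrank_eq_succ hE
  rw [collinear_iff_finrank_le_one]
  have hle : vectorSpan ℝ s ≤ LinearMap.ker a := by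
    rw [vectorSpan_def, Submodule.span_le]
    rintro _ ⟨x, hx, y, hy, rfl⟩
    simp [hs x hx, hs y hy]
  have h1 := Submodule.finrank_mono hle
  have h2 := a.finrank_range_add_finrank_ker
  rw [LinearMap.range_eq_top.2 (LinearMap.surjective ha), finrank_top, Module.finrank_self,
    hE] at h2
  omega

/-- In the plane, hat functions are automatically well defined: two different elements meet in a
face with at most two vertices, on which linear precision determines the coordinates. -/
theorem agreeOnSharedFaces_two {M : PolytopalMesh 2} {p : ℕ} {v : Fin p → Euc 2}
    (hv : M.IsVertexOrdering v) {lam : Set (Euc 2) → Fin p → Euc 2 → ℝ}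
    (hlam : ∀ m ∈ M.cells, IsGenBarycentric m v (lam m)) : AgreeOnSharedFaces M v lam := by
  intro m hm m' hm' x hx i
  rcases eq_or_ne m m' with rfl | hne
  · rfl
  have hF := M.inter_face m hm m' hm'
  have hF' := M.inter_face m' hm' m hm
  rw [inter_comm] at hF'
  -- The common face is on a line: a vanishing functional would expose the whole element.
  obtain ⟨a, ha, r, har⟩ : ∃ a : Euc 2 →ₗ[ℝ] ℝ, a ≠ 0 ∧ ∃ r, ∀ y ∈ m ∩ m', a y = r := by
    obtain ⟨a, ha⟩ := hF ⟨x, hx⟩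
    obtain ⟨b, hb⟩ := hF' ⟨x, hx⟩
    have aux : ∀ (c : StrongDual ℝ (Euc 2)) (q : Set (Euc 2)),
        m ∩ m' = {x ∈ q | ∀ y ∈ q, c y ≤ c x} → ∀ y ∈ m ∩ m', c y = c x := by
      intro c q hc y hy
      rw [hc] at hx hy
      exact le_antisymm (hx.2 y hy.1) (hy.2 x hx.1)
    by_cases ha0 : a = 0
    · by_cases hb0 : b = 0
      · refine absurd ?_ hne
        rw [← show m ∩ m' = m by simpa [ha0] using ha]
        simpa [hb0] using hb
      · exact ⟨b, fun h ↦ hb0 (ContinuousLinearMap.coe_injective h), b x, aux b m' hb⟩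
    · exact ⟨a, fun h ↦ ha0 (ContinuousLinearMap.coe_injective h), a x, aux a m ha⟩
  set d : Fin p → ℝ := fun k ↦ localHat m v (lam m) k x - localHat m' v (lam m') k x with hd
  have hd0 : ∀ k, v k ∉ m ∩ m' → d k = 0 := fun k hk ↦ by
    simp [hd, (hlam m hm).localHat_eq_zero hF hx hk, (hlam m' hm').localHat_eq_zero hF' hx hk]
  have hdL : ∀ L : Euc 2 →ᵃ[ℝ] ℝ, ∑ k, L (v k) * d k = 0 := fun L ↦ by
    simp [hd, mul_sub, (hlam m hm).sum_mul_localHat L hx.1, (hlam m' hm').sum_mul_localHat L hx.2]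
  suffices d i = 0 from sub_eq_zero.1 this
  by_cases hi : v i ∈ m ∩ m'
  swap
  · exact hd0 i hi
  by_cases hj : ∃ j, j ≠ i ∧ v j ∈ m ∩ m'
  · obtain ⟨j, hji, hj⟩ := hj
    have ext : ∀ k, v k ∈ m ∩ m' → v k ∈ (m ∩ m').extremePoints ℝ := fun k hk ↦
      inter_extremePoints_subset_extremePoints_of_subset inter_subset_left
        ⟨hk, hv.mem_extremePoints hm hk.1⟩
    have hother : ∀ k, k ≠ i → k ≠ j → v k ∉ m ∩ m' := fun k hki hkj hk ↦
      not_collinear_of_mem_extremePoints (ext k hk) (ext i hi) (ext j hj) (hv.1.ne hki)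
        (hv.1.ne hkj) (hv.1.ne hji.symm) <| collinear_of_forall_eq (by simp) ha (r := r) (by
          rintro y (rfl | rfl | rfl)
          exacts [har _ hk, har _ hi, har _ hj])
    -- An affine function vanishing at `v j` but not at `v i`.
    let b : Euc 2 →ᵃ[ℝ] ℝ := (innerSL ℝ (v i - v j)).toLinearMap.toAffineMap -
      AffineMap.const ℝ (Euc 2) (inner ℝ (v i - v j) (v j))
    have hb : ∀ y, b y = inner ℝ (v i - v j) (y - v j) := fun y ↦ by
      simp [b, inner_sub_right, -map_sub]
    have := hdL b
    rw [Finset.sum_eq_single i (fun k _ hki ↦ ?_) (by simp)] at this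
    · refine (mul_eq_zero.1 this).resolve_left ?_
      rw [hb]
      exact inner_self_ne_zero.2 (sub_ne_zero.2 (hv.1.ne hji.symm))
    · rcases eq_or_ne k j with rfl | hkj
      · simp [hb]
      · rw [hd0 k (hother k hki hkj), mul_zero]
  · push Not at hj
    have := hdL (AffineMap.const ℝ (Euc 2) 1)
    rw [Finset.sum_eq_single i (fun k _ hki ↦ by rw [hd0 k (hj k hki), mul_zero]) (by simp)] at this
    simpa using this

section HatFunction

variable {n p : ℕ} {M : PolytopalMesh n} {v : Fin p → Euc n}
  {lam : Set (Euc n) → Fin p → Euc n → ℝ}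

theorem AgreeOnSharedFaces.hatFunction_eq (h : AgreeOnSharedFaces M v lam) {m : Set (Euc n)}
    (hm : m ∈ M.cells) {x : Euc n} (hx : x ∈ m) (i : Fin p) :
    hatFunction M v lam i x = localHat m v (lam m) i x := by
  have hex : ∃ m ∈ M.cells, x ∈ m := ⟨m, hm, hx⟩
  rw [hatFunction, dif_pos hex]
  exact h _ hex.choose_spec.1 m hm x ⟨hex.choose_spec.2, hx⟩ i

/-- The hat functions are Lipschitz across the interfaces of the mesh. -/
theorem AgreeOnSharedFaces.exists_locallyLipschitzBy (h : AgreeOnSharedFaces M v lam)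
    (hlip : LipschitzOnElements M v lam) (i : Fin p) :
    ∃ K, LocallyLipschitzBy K M.domain (hatFunction M v lam i) := by
  have hK : ∀ m, ∃ K, m ∈ M.cells → LipschitzOnWith K (hatFunction M v lam i) m := by
    intro m
    by_cases hm : m ∈ M.cells
    swap
    · exact ⟨0, fun h ↦ absurd h hm⟩
    by_cases hi : v i ∈ m
    · obtain ⟨K, hK⟩ := hlip m hm i hi
      refine ⟨K, fun _ x hx y hy ↦ ?_⟩
      simpa [h.hatFunction_eq hm hx, h.hatFunction_eq hm hy, localHat, hi] using hK hx hy
    · refine ⟨0, fun _ x hx y hy ↦ ?_⟩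
      simp [h.hatFunction_eq hm hx, h.hatFunction_eq hm hy, localHat, hi]
  choose K hK using hK
  refine ⟨M.cells.sup K, fun x hx ↦ ?_⟩
  obtain ⟨ε, hε, hball⟩ := Metric.isOpen_iff.1 isOpen_interior x hx
  exact ⟨ball x ε, ball_mem_nhds x hε, (convex_ball x ε).lipschitzOnWith_of_finite_closed_cover
    (fun m hm ↦ (M.isCompact_cell hm).isClosed) (hball.trans interior_subset)
    fun m hm ↦ (hK m hm).weaken (Finset.le_sup hm)⟩

theorem AgreeOnSharedFaces.memHCurl_of_mem_span (h : AgreeOnSharedFaces M v lam)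
    (hlam : ∀ m ∈ M.cells, IsGenBarycentric m v (lam m)) (hlip : LipschitzOnElements M v lam)
    {u : Euc n → Euc n} (hu : u ∈ Submodule.span ℝ (hatGradHatFields M v lam)) :
    MemHCurl M.domain u := by
  induction hu using Submodule.span_induction with
  | zero => exact MemHCurl.zero
  | add u w _ _ hu hw => exact hu.add hw
  | smul a u _ hu => exact hu.smul a
  | mem u hu =>
    obtain ⟨i, j, -, rfl⟩ := hu
    obtain ⟨K, hK⟩ := h.exists_locallyLipschitzBy hlip i
    obtain ⟨L, hL⟩ := h.exists_locallyLipschitzBy hlip j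
    refine hK.memHCurl_smul_gradient isOpen_interior M.isBounded_domain (b := 1)
      (fun x hx ↦ ?_) hL
    obtain ⟨m, hm, hxm⟩ := mem_iUnion₂.1 (interior_subset hx)
    rw [h.hatFunction_eq hm hxm]
    exact (hlam m hm).abs_localHat_le_one i hxm

end HatFunction

end

theorem theorem3p3 :
    -- dimension two (here the coordinates agree on shared edges automatically)
    (∀ (M : PolytopalMesh 2) (p : ℕ) (v : Fin p → Euc 2) (_ : M.IsVertexOrdering v)
        (lam : Set (Euc 2) → Fin p → Euc 2 → ℝ)
        (_ : ∀ m ∈ M.cells, IsGenBarycentric m v (lam m))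
        (_ : LipschitzOnElements M v lam)
        (u : Euc 2 → Euc 2) (_ : u ∈ Submodule.span ℝ (hatGradHatFields M v lam)),
        MemHCurl2 M.domain u) ∧
    -- dimension three
    (∀ (M : PolytopalMesh 3) (p : ℕ) (v : Fin p → Euc 3) (_ : M.IsVertexOrdering v)
        (lam : Set (Euc 3) → Fin p → Euc 3 → ℝ)
        (_ : ∀ m ∈ M.cells, IsGenBarycentric m v (lam m))
        (_ : LipschitzOnElements M v lam)
        (_ : AgreeOnSharedFaces M v lam)
        (u : Euc 3 → Euc 3) (_ : u ∈ Submodule.span ℝ (hatGradHatFields M v lam)),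
        MemHCurl3 M.domain u) :=
  ⟨fun _ _ _ hv _ hlam hlip _ hu ↦
    ((agreeOnSharedFaces_two hv hlam).memHCurl_of_mem_span hlam hlip hu).memHCurl2,
  fun _ _ _ _ _ hlam hlip hagree _ hu ↦
    (hagree.memHCurl_of_mem_span hlam hlip hu).memHCurl3⟩
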